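/- Let $n\ge 1$ and let $\{0,1\}^n$ be the discrete cube, viewed as a graph in which two vertices are adjacent iff they differ in exactly one coordinate. For a nonempty set $A\subseteq\{0,1\}^n$ let $\partial A$ be the set of edges between $A$ and its complement, for $x\in A$ let $d_{out}(x)$ be the number of neighbors of $x$ outside $A$, and let $d_A(x)$ be the degree of $x$ in the subgraph induced by $A$. Let $0\le\varepsilon'\le 1$ and $0<\delta\le 1$, put $$\varepsilon=\frac{\varepsilon'}{2n}\cdot\log_2\Bigl(\frac{2^n}{|A|}\Bigr),$$ and suppose that $$|\partial A|\le(1+\varepsilon)\cdot|A|\log_2\Bigl(\frac{2^n}{|A|}\Bigr).$$ Then for $x$ chosen uniformly at random from $A$, $$\Pr\Bigl\{(1-\delta)\log_2\Bigl(\frac{2^n}{|A|}\Bigr)\le d_{out}(x)\le(1+\varepsilon)(1+\delta)\log_2\Bigl(\frac{2^n}{|A|}\Bigr)\Bigr\}\ge 1-\frac{\varepsilon'}{\delta^2}.$$ In particular, the subgraph induced by $A$ is nearly regular, with almost all degrees close to $\log_2|A|$, in the sense that $$\Pr\Bigl\{\log_2|A|-\bigl((1+\varepsilon)(1+\delta)-1\bigr)\log_2\Bigl(\frac{2^n}{|A|}\Bigr)\le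 d_A(x)\le\log_2|A|+\delta\log_2\Bigl(\frac{2^n}{|A|}\Bigr)\Bigr\}\ge 1-\frac{\varepsilon'}{\delta^2}.$$ -/

import Mathlib

/-- The discrete cube `{0,1}^n` as a graph: two boolean strings of length `n` are connected by an
edge iff they differ in exactly one coordinate. -/
def cubeGraph (n : ℕ) : SimpleGraph (Fin n → Bool) where
  Adj x y := hammingDist x y = 1
  symm := ⟨fun x y h => by rw [hammingDist_comm]; exact h⟩
  loopless := ⟨fun x h => by simp at h⟩

/-- The edge boundary of `A`: the set of (unordered) edges of `G` between `A` and its complement. -/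
def edgeBoundary {V : Type*} (G : SimpleGraph V) (A : Set V) : Set (Sym2 V) :=
  {e | e ∈ G.edgeSet ∧ ∃ x ∈ A, ∃ y ∉ A, e = s(x, y)}

/-- The out-degree of `x` with respect to `A`: the number of neighbors of `x` outside `A`. -/
noncomputable def outDegree {V : Type*} (G : SimpleGraph V) (A : Set V) (x : V) : ℕ :=
  {y | G.Adj x y ∧ y ∉ A}.ncard

/-- The degree of a vertex of `A` in the subgraph of `G` induced by `A`. -/
noncomputable def inducedDegree {V : Type*} (G : SimpleGraph V) (A : Set V) (x : A) : ℕ :=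
  ((G.induce A).neighborSet x).ncard

/-! Write L = log₂(2^n/|A|). The engine is a functional edge-isoperimetric inequality,
`sq_sum_le_cubeEnergy`: a nonnegative f supported on A has energy at least 2L(∑ f)²/|A|. It follows
by induction on n: cut the cube into two halves, and pay for merging them with the edges across the
cut, through `two_point` and `sq_sum_sub_div_max_le`. When |∂A| is close to |A|L, the indicator of A
is nearly extremal, so no perturbation of it can gain much. Testing on 1 - (d_out - L)/(2n) over A
gives ∑ (d_out - L)² ≤ 2n(|∂A| - |A|L), which is `sum_sq_outDegree_sub_le`. By the choice of ε the
right side is at most ε'|A|L², and Chebyshev's inequality at distance δL concludes. The claim on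
induced degrees is the same event, since d_A = n - d_out. -/

/-! ### Scalar and two-point inequalities. -/

theorem log_le_half_sub_inv {u : ℝ} (hu : 1 ≤ u) : Real.log u ≤ (u - u⁻¹) / 2 := by
  rw [← Real.sinh_log (by linarith)]
  exact Real.self_le_sinh_iff.2 (Real.log_nonneg hu)

theorem neg_log_ge_of_lt_one {x : ℝ} (hx0 : 0 < x) (hx1 : x < 1) :
    2 * (1 - x) / (1 + x) ≤ -Real.log x := by
  have h := Real.le_log_one_add_of_nonneg (x := x⁻¹ - 1)
    (by have := (one_lt_inv₀ hx0).2 hx1; linarith)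
  rw [show (1 : ℝ) + (x⁻¹ - 1) = x⁻¹ by ring, Real.log_inv] at h
  refine le_trans (le_of_eq ?_) h
  have : x⁻¹ - 1 + 2 = (1 + x) / x := by field_simp; ring
  rw [this]
  field_simp

/-- The scalar inequality behind the two-point estimate, away from `0`. -/
theorem inv_log_two_add_le_of_ge {x : ℝ} (hx0 : 1 / 8 ≤ x) (hx1 : x < 1) :
    1 / Real.log 2 + 4 * x / (-Real.log x) ≤ (1 + x) / (Real.log 2 - Real.log (1 + x)) := by
  have hx : 0 < x := by linarith
  have h1x : 0 < 1 - x := by linarith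
  have hl := neg_log_ge_of_lt_one hx hx1
  have hu := log_le_half_sub_inv (u := 2 / (1 + x)) (by rw [le_div_iff₀] <;> linarith)
  rw [Real.log_div (by norm_num) (by linarith)] at hu
  have hm : 0 < Real.log 2 - Real.log (1 + x) := by
    have := Real.log_lt_log (by linarith : 0 < 1 + x) (by linarith : 1 + x < 2)
    linarith
  have e1 : 1 / Real.log 2 ≤ 1.45 := by
    rw [div_le_iff₀ (by positivity)]
    have := Real.log_two_gt_d9
    linarith
  have e2 : 4 * x / (-Real.log x) ≤ 4 * x / (2 * (1 - x) / (1 + x)) := by gcongr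
  have e3 : (1 + x) / ((2 / (1 + x) - (2 / (1 + x))⁻¹) / 2)
      ≤ (1 + x) / (Real.log 2 - Real.log (1 + x)) := by gcongr
  have e4 : (2 / (1 + x) - (2 / (1 + x))⁻¹) / 2 = (1 - x) * (3 + x) / (4 * (1 + x)) := by
    field_simp; ring
  rw [e4] at e3
  refine le_trans (add_le_add e1 e2) (le_trans ?_ e3)
  rw [← sub_nonneg]
  have : (1 + x) / ((1 - x) * (3 + x) / (4 * (1 + x))) - (1.45 + 4 * x / (2 * (1 - x) / (1 + x)))
      = (2 * (2 + x) * (1 + x) - 1.45 * (3 + x)) / (3 + x) := by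
    field_simp; ring
  rw [this]
  apply div_nonneg _ (by linarith)
  nlinarith

/-- Near 0 the rational bounds of the other range are too weak: at x = 0 they would need 4 ≥ 1.45 ·
3. Here -log x ≥ 3 log 2 ≥ 2 and log(1 + x) ≥ 8x/9 suffice. -/
theorem inv_log_two_add_le_of_le {x : ℝ} (hx0 : 0 < x) (hx1 : x ≤ 1 / 8) :
    1 / Real.log 2 + 4 * x / (-Real.log x) ≤ (1 + x) / (Real.log 2 - Real.log (1 + x)) := by
  have c1 := Real.log_two_gt_d9
  have c2 := Real.log_two_lt_d9
  have hc : 0 < Real.log 2 := by positivity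
  have hm : 0 < Real.log 2 - Real.log (1 + x) := by
    have := Real.log_lt_log (by linarith : 0 < 1 + x) (by linarith : 1 + x < 2)
    linarith
  have hl : 2 ≤ -Real.log x := by
    have h := Real.log_le_log hx0 hx1
    rw [show (1 / 8 : ℝ) = (2 ^ 3)⁻¹ by norm_num, Real.log_inv, Real.log_pow] at h
    push_cast at h
    linarith
  have e1 : 4 * x / (-Real.log x) ≤ 4 * x / 2 := by gcongr
  have hlow : 8 / 9 * x ≤ Real.log (1 + x) := by
    have h := Real.one_sub_inv_le_log_of_pos (by linarith : 0 < 1 + x)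
    refine le_trans ?_ h
    rw [show 1 - (1 + x)⁻¹ = x / (1 + x) by field_simp; ring, le_div_iff₀ (by linarith)]
    nlinarith
  rw [le_div_iff₀ hm]
  calc _ ≤ (1 / Real.log 2 + 4 * x / 2) * (Real.log 2 - 8 / 9 * x) := by
        apply mul_le_mul (by linarith) (by linarith) hm.le (by positivity)
    _ = 1 + 2 * x * Real.log 2 - 8 / 9 * x * (1 / Real.log 2) - 16 / 9 * x ^ 2 := by
        field_simp; ring
    _ ≤ _ := by
        have : 1.4 ≤ 1 / Real.log 2 := by rw [le_div_iff₀ hc]; linarith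
        nlinarith

theorem add_sq_le_mul_add {p q u v : ℝ} (hp : 0 < p) (hq : 0 < q) :
    (u + v) ^ 2 ≤ (u ^ 2 / p + v ^ 2 / q) * (p + q) := by
  rw [← sub_nonneg]
  have : (u ^ 2 / p + v ^ 2 / q) * (p + q) - (u + v) ^ 2 = (u * q - v * p) ^ 2 / (p * q) := by
    field_simp; ring
  rw [this]; positivity

/-- Cauchy–Schwarz for s + t = (s - t) + 2t, with weights 1/log 2 and 4x/(-log x), eliminates s and
t and leaves an inequality in x alone. -/
theorem two_point_scalar {x : ℝ} (hx0 : 0 < x) (hx1 : x ≤ 1) (s t : ℝ) :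
    (s + t) ^ 2 / (1 + x) * (Real.log 2 - Real.log (1 + x))
      ≤ t ^ 2 / x * (-Real.log x) + Real.log 2 * (s - t) ^ 2 := by
  have hc : 0 < Real.log 2 := by positivity
  rcases hx1.eq_or_lt with rfl | hx1
  · norm_num; positivity
  have hl : 0 < -Real.log x := by have := Real.log_neg hx0 hx1; linarith
  have hm : 0 < Real.log 2 - Real.log (1 + x) := by
    have := Real.log_lt_log (by linarith : 0 < 1 + x) (by linarith : 1 + x < 2)
    linarith
  have key : 1 / Real.log 2 + 4 * x / (-Real.log x)
      ≤ (1 + x) / (Real.log 2 - Real.log (1 + x)) := by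
    rcases le_total x (1 / 8) with h | h
    · exact inv_log_two_add_le_of_le hx0 h
    · exact inv_log_two_add_le_of_ge h hx1
  have cs := add_sq_le_mul_add (u := s - t) (v := 2 * t) (p := 1 / Real.log 2)
    (q := 4 * x / (-Real.log x)) (by positivity) (by positivity)
  rw [show s - t + 2 * t = s + t by ring] at cs
  have e : (s - t) ^ 2 / (1 / Real.log 2) + (2 * t) ^ 2 / (4 * x / (-Real.log x))
      = t ^ 2 / x * (-Real.log x) + Real.log 2 * (s - t) ^ 2 := by
    field_simp; ring
  rw [e] at cs
  have h2 : (s + t) ^ 2 ≤ (t ^ 2 / x * (-Real.log x) + Real.log 2 * (s - t) ^ 2)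
      * ((1 + x) / (Real.log 2 - Real.log (1 + x))) :=
    cs.trans (mul_le_mul_of_nonneg_left key (by positivity))
  rw [← mul_div_assoc, le_div_iff₀ hm] at h2
  rw [div_mul_eq_mul_div, div_le_iff₀ (by linarith)]
  exact h2

/-- Both sides are affine in M. The coefficients of M - log a compare by Cauchy–Schwarz, and what
remains, the case M = log a, is `two_point_scalar` at x = b/a. -/
theorem two_point_of_le {a b M : ℝ} (hb : 0 < b) (hba : b ≤ a) (hM : Real.log a ≤ M) (s t : ℝ) :
    (s + t) ^ 2 / (a + b) * (M + Real.log 2 - Real.log (a + b))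
      ≤ s ^ 2 / a * (M - Real.log a) + t ^ 2 / b * (M - Real.log b)
        + Real.log 2 * ((s - t) ^ 2 / a) := by
  have ha : 0 < a := hb.trans_le hba
  obtain ⟨x, rfl⟩ : ∃ x, b = a * x := ⟨b / a, by field_simp⟩
  have hx0 : 0 < x := by simpa [ha] using hb
  have hx1 : x ≤ 1 := by
    by_contra! h
    nlinarith
  have h := two_point_scalar hx0 hx1 s t
  have hK : (M - Real.log a) * ((s + t) ^ 2 / (1 + x)) ≤ (M - Real.log a) * (s ^ 2 + t ^ 2 / x) := by
    apply mul_le_mul_of_nonneg_left _ (by linarith)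
    rw [div_le_iff₀ (by linarith)]
    have := add_sq_le_mul_add (u := s) (v := t) one_pos hx0
    simpa using this
  rw [show a + a * x = a * (1 + x) by ring, Real.log_mul ha.ne' (by positivity),
    Real.log_mul ha.ne' hx0.ne']
  have h3 := div_le_div_of_nonneg_right (add_le_add h hK) ha.le
  refine (le_of_eq ?_).trans (h3.trans (le_of_eq ?_))
  · field_simp; ring
  · field_simp; ring

/-- The two-point inequality that drives the induction on the dimension. -/
theorem two_point {a b : ℕ} {M s t : ℝ} (ha : Real.log a ≤ M) (hb : Real.log b ≤ M)
    (hs : a = 0 → s = 0) (ht : b = 0 → t = 0) :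
    (s + t) ^ 2 / (a + b : ℝ) * (M + Real.log 2 - Real.log (a + b))
      ≤ s ^ 2 / a * (M - Real.log a) + t ^ 2 / b * (M - Real.log b)
        + Real.log 2 * ((s - t) ^ 2 / max (a : ℝ) b) := by
  -- An empty half contributes 0, as s = 0 and division by 0 is 0; the two sides then agree.
  rcases Nat.eq_zero_or_pos a with rfl | ha0
  · simp only [hs rfl]
    simp
    ring_nf; rfl
  rcases Nat.eq_zero_or_pos b with rfl | hb0
  · simp only [ht rfl]
    simp
    ring_nf; rfl
  have ha' : (0 : ℝ) < a := by exact_mod_cast ha0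
  have hb' : (0 : ℝ) < b := by exact_mod_cast hb0
  rcases le_total (b : ℝ) a with h | h
  · rw [max_eq_left h]
    exact two_point_of_le hb' h ha s t
  · rw [max_eq_right h]
    have := two_point_of_le ha' h hb t s
    rw [add_comm t s, add_comm (b : ℝ) a, show (t - s) ^ 2 = (s - t) ^ 2 by ring] at this
    linarith

/-! ### Cauchy–Schwarz across the cut. -/

/-- Off A the difference f - g = -g only lowers the sum, so Cauchy–Schwarz is needed on A alone and
costs |A| rather than the size of the union of supports. -/
theorem sq_sum_sub_le {V : Type*} [Fintype V] (f g : V → ℝ) (A : Finset V)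
    (hg : ∀ x, 0 ≤ g x) (hf : ∀ x ∉ A, f x = 0) (hgf : ∑ x, g x ≤ ∑ x, f x) :
    (∑ x, f x - ∑ x, g x) ^ 2 ≤ A.card * ∑ x, (f x - g x) ^ 2 := by
  classical
  have h1 : ∑ x, f x - ∑ x, g x ≤ ∑ x ∈ A, (f x - g x) := by
    rw [← Finset.sum_sub_distrib, ← Finset.sum_add_sum_compl A]
    have : ∑ x ∈ Aᶜ, (f x - g x) ≤ 0 := Finset.sum_nonpos fun x hx => by
      rw [hf x (by simpa using hx)]
      have := hg x
      linarith
    linarith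
  calc _ ≤ (∑ x ∈ A, (f x - g x)) ^ 2 := by gcongr
    _ ≤ A.card * ∑ x ∈ A, (f x - g x) ^ 2 := sq_sum_le_card_mul_sum_sq
    _ ≤ _ := by
      gcongr
      exact Finset.subset_univ A

theorem sq_sum_sub_div_max_le {V : Type*} [Fintype V] (f g : V → ℝ) (A B : Finset V)
    (hf0 : ∀ x, 0 ≤ f x) (hg0 : ∀ x, 0 ≤ g x) (hf : ∀ x ∉ A, f x = 0) (hg : ∀ x ∉ B, g x = 0) :
    (∑ x, f x - ∑ x, g x) ^ 2 / max (A.card : ℝ) B.card ≤ ∑ x, (f x - g x) ^ 2 := by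
  have hn : 0 ≤ ∑ x, (f x - g x) ^ 2 := Finset.sum_nonneg fun x _ => sq_nonneg _
  apply div_le_of_le_mul₀ (by positivity) hn
  rw [mul_comm]
  rcases le_total (∑ x, g x) (∑ x, f x) with h | h
  · exact (sq_sum_sub_le f g A hg0 hf h).trans
      (mul_le_mul_of_nonneg_right (le_max_left _ _) hn)
  · have := sq_sum_sub_le g f B hf0 hg h
    rw [show (∑ x, g x - ∑ x, f x) ^ 2 = (∑ x, f x - ∑ x, g x) ^ 2 by ring,
      Finset.sum_congr rfl fun x _ => show (g x - f x) ^ 2 = (f x - g x) ^ 2 by ring] at this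
    exact this.trans (mul_le_mul_of_nonneg_right (le_max_right _ _) hn)

/-! ### Energy on the cube and functional isoperimetry. -/

/-- Flip the `i`-th coordinate of a vertex of the cube. -/
def flipCoord {n : ℕ} (i : Fin n) (x : Fin n → Bool) : Fin n → Bool :=
  Function.update x i (!x i)

@[simp] theorem flipCoord_flipCoord {n : ℕ} (i : Fin n) (x : Fin n → Bool) :
    flipCoord i (flipCoord i x) = x := by
  simp [flipCoord]

theorem flipCoord_zero_cons {n : ℕ} (b : Bool) (y : Fin n → Bool) :
    flipCoord 0 (Fin.cons b y : Fin (n + 1) → Bool) = Fin.cons (!b) y := by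
  simp [flipCoord, Fin.update_cons_zero]

theorem flipCoord_succ_cons {n : ℕ} (i : Fin n) (b : Bool) (y : Fin n → Bool) :
    flipCoord i.succ (Fin.cons b y : Fin (n + 1) → Bool) = Fin.cons b (flipCoord i y) := by
  simp [flipCoord, ← Fin.cons_update]

/-- The energy of a function on the cube: the sum of squared differences over oriented edges. -/
def cubeEnergy {n : ℕ} (f : (Fin n → Bool) → ℝ) : ℝ :=
  ∑ x, ∑ i, (f x - f (flipCoord i x)) ^ 2

theorem sum_cube_succ {n : ℕ} (F : (Fin (n + 1) → Bool) → ℝ) :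
    ∑ x, F x = ∑ y : Fin n → Bool, F (Fin.cons false y) + ∑ y : Fin n → Bool, F (Fin.cons true y) := by
  rw [← (Fin.consEquiv (fun _ => Bool)).sum_comp, Fintype.sum_prod_type]
  simp [Fin.consEquiv, add_comm]

theorem cubeEnergy_succ {n : ℕ} (f : (Fin (n + 1) → Bool) → ℝ) :
    cubeEnergy f = cubeEnergy (fun y => f (Fin.cons false y))
      + cubeEnergy (fun y => f (Fin.cons true y))
      + 2 * ∑ y : Fin n → Bool, (f (Fin.cons false y) - f (Fin.cons true y)) ^ 2 := by
  simp only [cubeEnergy, sum_cube_succ, Fin.sum_univ_succ, flipCoord_zero_cons,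
    flipCoord_succ_cons, Finset.sum_add_distrib, Bool.not_false, Bool.not_true]
  rw [Finset.sum_congr rfl fun (y : Fin n → Bool) _ =>
    show (f (Fin.cons true y) - f (Fin.cons false y)) ^ 2
      = (f (Fin.cons false y) - f (Fin.cons true y)) ^ 2 by ring]
  ring

theorem log_card_cube_le {n : ℕ} (A : Finset (Fin n → Bool)) :
    Real.log A.card ≤ n * Real.log 2 := by
  rcases A.eq_empty_or_nonempty with rfl | hA
  · simp; positivity
  rw [← Real.log_pow]
  apply Real.log_le_log (by exact_mod_cast hA.card_pos)
  have := A.card_le_univ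
  simp at this
  exact_mod_cast this

/-- The edge-isoperimetric inequality for nonnegative functions supported on `A`. -/
theorem sq_sum_le_cubeEnergy {n : ℕ} (f : (Fin n → Bool) → ℝ) (A : Finset (Fin n → Bool))
    (hf0 : ∀ x, 0 ≤ f x) (hf : ∀ x ∉ A, f x = 0) :
    2 * ((∑ x, f x) ^ 2 / A.card * (n * Real.log 2 - Real.log A.card))
      ≤ Real.log 2 * cubeEnergy f := by
  induction n with
  | zero =>
    have h0 : cubeEnergy f = 0 := by simp [cubeEnergy]
    have : A.card ≤ 1 := by simpa using A.card_le_univ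
    interval_cases h : A.card <;> simp [h0]
  | succ n ih =>
    classical
    set B : Bool → Finset (Fin n → Bool) := fun b => {y | (Fin.cons b y : Fin (n + 1) → Bool) ∈ A}
      with hB
    have hcard : (A.card : ℝ) = (B false).card + (B true).card := by
      have := sum_cube_succ (fun x => if x ∈ A then (1 : ℝ) else 0)
      simpa [hB, Finset.sum_boole] using this
    have hsupp : ∀ b, ∀ y ∉ B b, f (Fin.cons b y) = 0 := fun b y hy =>
      hf _ (by simpa [hB] using hy)
    have hzero : ∀ b, (B b).card = 0 → ∑ y, f (Fin.cons b y) = 0 := fun b h =>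
      Finset.sum_eq_zero fun y _ => hsupp b y (by rw [Finset.card_eq_zero.1 h]; simp)
    have i0 := ih (fun y => f (Fin.cons false y)) (B false) (fun _ => hf0 _) (hsupp false)
    have i1 := ih (fun y => f (Fin.cons true y)) (B true) (fun _ => hf0 _) (hsupp true)
    have hd := sq_sum_sub_div_max_le (fun y : Fin n → Bool => f (Fin.cons false y))
      (fun y => f (Fin.cons true y)) (B false) (B true) (fun _ => hf0 _) (fun _ => hf0 _)
      (hsupp false) (hsupp true)
    -- The last term of `two_point` is paid by the edges across the cut, which the energy counts in
    -- both orientations.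
    have tp := two_point (log_card_cube_le (B false)) (log_card_cube_le (B true))
      (hzero false) (hzero true)
    have hd' := mul_le_mul_of_nonneg_left hd (Real.log_nonneg one_le_two)
    rw [cubeEnergy_succ, sum_cube_succ, hcard]
    push_cast
    rw [show ((n : ℝ) + 1) * Real.log 2 = n * Real.log 2 + Real.log 2 by ring]
    linarith

/-! ### Degrees and the edge boundary via coordinate flips. -/

theorem flipCoord_injective {n : ℕ} (x : Fin n → Bool) :
    Function.Injective fun i => flipCoord i x := by
  intro i j h
  by_contra hij
  have := congrFun h i
  simp [flipCoord, Function.update_of_ne hij] at this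

theorem cubeGraph_adj_iff {n : ℕ} (x y : Fin n → Bool) :
    (cubeGraph n).Adj x y ↔ ∃ i, flipCoord i x = y := by
  change hammingDist x y = 1 ↔ _
  rw [hammingDist, Finset.card_eq_one]
  refine exists_congr fun i => ?_
  constructor
  · intro h
    ext j
    have hj := Finset.ext_iff.1 h j
    simp only [Finset.mem_filter, Finset.mem_univ, true_and, Finset.mem_singleton] at hj
    by_cases hji : j = i
    · subst hji
      have : x j ≠ y j := hj.2 rfl
      cases hx : x j <;> cases hy : y j <;> simp_all [flipCoord]
    · have : x j = y j := by by_contra h; exact hji (hj.1 h)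
      simp [flipCoord, hji, this]
  · rintro rfl
    ext j
    rw [Finset.mem_filter]
    by_cases hji : j = i
    · subst hji; simp [flipCoord]
    · simp [flipCoord, hji]

open Classical in
theorem outDegree_cubeGraph {n : ℕ} (A : Set (Fin n → Bool)) (x : Fin n → Bool) :
    outDegree (cubeGraph n) A x = (Finset.univ.filter fun i => flipCoord i x ∉ A).card := by
  rw [outDegree, ← Finset.card_image_of_injective _ (flipCoord_injective x), ← Set.ncard_coe_finset]
  congr 1
  ext y
  simp only [cubeGraph_adj_iff, Set.mem_ofPred_eq, Finset.coe_image, Finset.coe_filter,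
    Finset.mem_univ, true_and, Set.mem_image]
  constructor
  · rintro ⟨⟨i, rfl⟩, h⟩; exact ⟨i, h, rfl⟩
  · rintro ⟨i, h, rfl⟩; exact ⟨⟨i, rfl⟩, h⟩

open Classical in
theorem inducedDegree_cubeGraph {n : ℕ} (A : Set (Fin n → Bool)) (x : A) :
    inducedDegree (cubeGraph n) A x
      = (Finset.univ.filter fun i => flipCoord i x.1 ∈ A).card := by
  rw [inducedDegree, ← Finset.card_image_of_injective _ (flipCoord_injective x.1),
    ← Set.ncard_coe_finset, ← Set.ncard_image_of_injective _ Subtype.val_injective]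
  congr 1
  ext y
  simp only [Set.mem_image, SimpleGraph.mem_neighborSet, SimpleGraph.comap_adj,
    Function.Embedding.subtype_apply, cubeGraph_adj_iff, Subtype.exists, exists_and_right,
    exists_eq_right, Finset.coe_image, Finset.coe_filter, Finset.mem_univ, true_and,
    Set.mem_ofPred_eq]
  constructor
  · rintro ⟨h, i, rfl⟩; exact ⟨i, h, rfl⟩
  · rintro ⟨i, h, rfl⟩; exact ⟨h, i, rfl⟩

theorem inducedDegree_add_outDegree {n : ℕ} (A : Set (Fin n → Bool)) (x : A) :
    inducedDegree (cubeGraph n) A x + outDegree (cubeGraph n) A x = n := by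
  classical
  rw [inducedDegree_cubeGraph, outDegree_cubeGraph, Finset.card_filter_add_card_filter_not]
  simp

theorem outDegree_le {n : ℕ} (A : Set (Fin n → Bool)) (x : Fin n → Bool) :
    outDegree (cubeGraph n) A x ≤ n := by
  classical
  rw [outDegree_cubeGraph]
  simpa using Finset.card_le_univ (Finset.univ.filter fun i => flipCoord i x ∉ A)

-- A boundary edge has exactly one endpoint in A, so it determines its pair (vertex of A,
-- direction).
open Classical in
theorem ncard_edgeBoundary_cubeGraph {n : ℕ} (A : Set (Fin n → Bool)) :
    (edgeBoundary (cubeGraph n) A).ncard = ∑ x ∈ A.toFinset, outDegree (cubeGraph n) A x := by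
  simp only [outDegree_cubeGraph]
  rw [← Finset.card_sigma]
  rw [← Finset.card_image_of_injOn (f := fun p : (_ : Fin n → Bool) × Fin n =>
    s(p.1, flipCoord p.2 p.1)), ← Set.ncard_coe_finset]
  · congr 1
    ext e
    simp only [edgeBoundary, Set.mem_ofPred_eq, Finset.coe_image, Set.mem_image, Finset.mem_coe,
      Finset.mem_sigma, Set.mem_toFinset, Finset.mem_filter, Finset.mem_univ, true_and,
      Sigma.exists]
    constructor
    · rintro ⟨he, x, hx, y, hy, rfl⟩
      rw [SimpleGraph.mem_edgeSet, cubeGraph_adj_iff] at he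
      obtain ⟨i, rfl⟩ := he
      exact ⟨x, i, ⟨hx, hy⟩, rfl⟩
    · rintro ⟨x, i, ⟨hx, hy⟩, rfl⟩
      exact ⟨(cubeGraph_adj_iff _ _).2 ⟨i, rfl⟩, x, hx, _, hy, rfl⟩
  · rintro ⟨x, i⟩ hp ⟨y, j⟩ hq h
    simp only [Finset.mem_coe, Finset.mem_sigma, Set.mem_toFinset, Finset.mem_filter,
      Finset.mem_univ, true_and] at hp hq
    simp only [Sym2.eq_iff] at h
    rcases h with ⟨rfl, h⟩ | ⟨h, -⟩
    · rw [flipCoord_injective x h]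
    · exact absurd (h ▸ hp.1) hq.2

/-! ### Perturbing the energy. -/

theorem sum_flipCoord {n : ℕ} (i : Fin n) (F : (Fin n → Bool) → ℝ) :
    ∑ x, F (flipCoord i x) = ∑ x, F x :=
  Equiv.sum_comp (Function.Involutive.toPerm (flipCoord i) (flipCoord_flipCoord i)) F

theorem cubeEnergy_le {n : ℕ} (g : (Fin n → Bool) → ℝ) :
    cubeEnergy g ≤ 4 * n * ∑ x, g x ^ 2 := by
  rw [cubeEnergy, Finset.sum_comm]
  calc _ ≤ ∑ i : Fin n, ∑ x, (2 * g x ^ 2 + 2 * g (flipCoord i x) ^ 2) := by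
        gcongr with i _ x _
        nlinarith [sq_nonneg (g x + g (flipCoord i x))]
    _ = ∑ i : Fin n, 4 * ∑ x, g x ^ 2 := by
        refine Finset.sum_congr rfl fun i _ => ?_
        rw [Finset.sum_add_distrib, ← Finset.mul_sum, ← Finset.mul_sum,
          sum_flipCoord i fun x => g x ^ 2]
        ring
    _ = _ := by simp; ring

/-- Expansion of the energy of a perturbation, with the mixed term symmetrized. -/
theorem cubeEnergy_add {n : ℕ} (f g : (Fin n → Bool) → ℝ) :
    cubeEnergy (fun x => f x + g x)
      = cubeEnergy f + 4 * ∑ x, g x * ∑ i, (f x - f (flipCoord i x)) + cubeEnergy g := by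
  have key : ∀ i : Fin n, ∑ x, (f x - f (flipCoord i x)) * (g x - g (flipCoord i x))
      = 2 * ∑ x, g x * (f x - f (flipCoord i x)) := by
    intro i
    have h := sum_flipCoord i fun x => g x * (f x - f (flipCoord i x))
    simp only [flipCoord_flipCoord] at h
    rw [two_mul]
    nth_rewrite 2 [← h]
    rw [← Finset.sum_add_distrib]
    exact Finset.sum_congr rfl fun x _ => by ring
  have h2 : ∑ x, g x * ∑ i, (f x - f (flipCoord i x))
      = ∑ i, ∑ x, g x * (f x - f (flipCoord i x)) := by
    rw [Finset.sum_comm]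
    simp only [Finset.mul_sum]
  have h3 : 4 * ∑ x, g x * ∑ i, (f x - f (flipCoord i x))
      = ∑ x, ∑ i, 2 * ((f x - f (flipCoord i x)) * (g x - g (flipCoord i x))) := by
    rw [Finset.sum_comm, h2, Finset.mul_sum]
    refine Finset.sum_congr rfl fun i _ => ?_
    rw [← Finset.mul_sum, key]
    ring
  rw [h3]
  simp only [cubeEnergy, ← Finset.sum_add_distrib]
  exact Finset.sum_congr rfl fun x _ => Finset.sum_congr rfl fun i _ => by ring

open Classical in
theorem sum_indicator_sub_flipCoord {n : ℕ} (A : Set (Fin n → Bool)) {x : Fin n → Bool}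
    (hx : x ∈ A) :
    ∑ i, ((if x ∈ A then (1 : ℝ) else 0) - if flipCoord i x ∈ A then 1 else 0)
      = outDegree (cubeGraph n) A x := by
  rw [outDegree_cubeGraph, ← Finset.sum_boole]
  refine Finset.sum_congr rfl fun i _ => ?_
  by_cases h : flipCoord i x ∈ A <;> simp [hx, h]

open Classical in
theorem cubeEnergy_indicator {n : ℕ} (A : Set (Fin n → Bool)) :
    cubeEnergy (fun x => if x ∈ A then (1 : ℝ) else 0)
      = 2 * ∑ x ∈ A.toFinset, (outDegree (cubeGraph n) A x : ℝ) := by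
  -- Expanding the energy of u + (-u) = 0 expresses the energy of the indicator u through its mixed
  -- term, the sum of out-degrees.
  have h := cubeEnergy_add (fun x => if x ∈ A then (1 : ℝ) else 0)
    (fun x => -if x ∈ A then (1 : ℝ) else 0)
  have h0 : cubeEnergy (fun x => (if x ∈ A then (1 : ℝ) else 0) + -if x ∈ A then (1 : ℝ) else 0)
      = 0 := by simp [cubeEnergy]
  have h1 : cubeEnergy (fun x => -if x ∈ A then (1 : ℝ) else 0)
      = cubeEnergy (fun x => if x ∈ A then (1 : ℝ) else 0) := by
    simp only [cubeEnergy]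
    exact Finset.sum_congr rfl fun x _ => Finset.sum_congr rfl fun i _ => by ring
  have h2 : ∑ x, (-if x ∈ A then (1 : ℝ) else 0)
      * ∑ i, ((if x ∈ A then (1 : ℝ) else 0) - if flipCoord i x ∈ A then 1 else 0)
      = -∑ x ∈ A.toFinset, (outDegree (cubeGraph n) A x : ℝ) := by
    rw [← Finset.sum_neg_distrib, ← Finset.sum_subset (Finset.subset_univ A.toFinset)]
    · refine Finset.sum_congr rfl fun x hx => ?_
      have hx : x ∈ A := by simpa using hx
      rw [sum_indicator_sub_flipCoord A hx, if_pos hx]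
      ring
    · intro x _ hx
      have hx : x ∉ A := by simpa using hx
      simp [hx]
  rw [h0, h1, h2] at h
  linarith

/-! ### Second moment of the out-degree, and concentration. -/

open Classical in
/-- If the edge boundary of `A` exceeds its minimum by little, then the out-degrees have small
second moment about `log₂ (2 ^ n / |A|)`. -/
theorem sum_sq_outDegree_sub_le {n : ℕ} (hn : 1 ≤ n) (A : Set (Fin n → Bool)) (hA : A.Nonempty)
    {L : ℝ} (hL : L = n - Real.logb 2 A.ncard) :
    ∑ x ∈ A.toFinset, ((outDegree (cubeGraph n) A x : ℝ) - L) ^ 2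
      ≤ 2 * n * ((edgeBoundary (cubeGraph n) A).ncard - A.ncard * L) := by
  have hn' : (0 : ℝ) < n := by exact_mod_cast hn
  set S := A.toFinset with hS
  have hcard : A.ncard = S.card := Set.ncard_eq_toFinset_card' A
  have hc : 0 < Real.log 2 := by positivity
  have hSpos : (0 : ℝ) < S.card := by
    have : S.Nonempty := by simpa [hS] using hA
    exact_mod_cast this.card_pos
  have hLc : n * Real.log 2 - Real.log S.card = Real.log 2 * L := by
    rw [hL, hcard, Real.logb]; field_simp
  have hL0 : 0 ≤ L := by
    have := log_card_cube_le S
    by_contra! h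
    nlinarith
  have hLn : L ≤ n := by
    rw [hL, hcard]
    have := Real.logb_nonneg one_lt_two (show (1 : ℝ) ≤ S.card by exact_mod_cast hSpos)
    linarith
  set h : (Fin n → Bool) → ℝ := fun x => (outDegree (cubeGraph n) A x : ℝ) - L with hh
  set u : (Fin n → Bool) → ℝ := fun x => if x ∈ A then (1 : ℝ) else 0 with hu
  -- With Q = ∑ h², the step 1/(2n) minimizes -4tQ + 4ntQ · t over t; it also keeps u + g
  -- nonnegative, since h ≤ n.
  set g : (Fin n → Bool) → ℝ := fun x => if x ∈ A then -(h x / (2 * n)) else 0 with hg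
  have hsum : ∀ F : (Fin n → Bool) → ℝ, (∑ x, if x ∈ A then F x else 0) = ∑ x ∈ S, F x := by
    intro F
    rw [← Finset.sum_filter]
    congr 1
    ext; simp [hS]
  have iso := sq_sum_le_cubeEnergy (fun x => u x + g x) S
    (fun x => by
      by_cases hx : x ∈ A
      · have : h x / (2 * n) ≤ 1 := by
          rw [div_le_one (by positivity)]
          have : (outDegree (cubeGraph n) A x : ℝ) ≤ n := by exact_mod_cast outDegree_le A x
          simp only [hh]
          linarith
        simp only [hu, hg, if_pos hx]
        linarith
      · simp [hu, hg, hx])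
    (fun x hx => by
      have hx : x ∉ A := by simpa [hS] using hx
      simp [hu, hg, hx])
  rw [hLc, cubeEnergy_add, cubeEnergy_indicator] at iso
  have e1 : ∑ x, (u x + g x) = S.card - (∑ x ∈ S, h x) / (2 * n) := by
    rw [Finset.sum_add_distrib, hsum, hsum, Finset.sum_neg_distrib, Finset.sum_div]
    simp
    ring
  have e2 : ∑ x, g x * ∑ i, (u x - u (flipCoord i x))
      = -((∑ x ∈ S, h x ^ 2) + L * ∑ x ∈ S, h x) / (2 * n) := by
    have : ∀ x, g x * ∑ i, (u x - u (flipCoord i x))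
        = if x ∈ A then -(h x ^ 2 + L * h x) / (2 * n) else 0 := by
      intro x
      by_cases hx : x ∈ A
      · simp only [hu, hg, if_pos hx]
        have := sum_indicator_sub_flipCoord A hx
        rw [if_pos hx] at this
        rw [this]
        simp only [hh]
        ring
      · simp [hg, hx]
    rw [Finset.sum_congr rfl fun x _ => this x, hsum, ← Finset.sum_div, Finset.sum_neg_distrib,
      Finset.sum_add_distrib, Finset.mul_sum]
  have e3 : ∑ x, g x ^ 2 = (∑ x ∈ S, h x ^ 2) / (2 * n) ^ 2 := by
    have : ∀ x, g x ^ 2 = if x ∈ A then h x ^ 2 / (2 * n) ^ 2 else 0 := by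
      intro x
      by_cases hx : x ∈ A
      · simp only [hg, if_pos hx]; ring
      · simp [hg, hx]
    rw [Finset.sum_congr rfl fun x _ => this x, hsum, Finset.sum_div]
  have e4 := cubeEnergy_le g
  rw [e3] at e4
  rw [e1, e2] at iso
  have e5 : ((edgeBoundary (cubeGraph n) A).ncard : ℝ)
      = ∑ x ∈ S, (outDegree (cubeGraph n) A x : ℝ) := by
    rw [ncard_edgeBoundary_cubeGraph]; push_cast; rfl
  rw [e5, hcard]
  set D := ∑ x ∈ S, (outDegree (cubeGraph n) A x : ℝ)
  set Q := ∑ x ∈ S, h x ^ 2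
  set H := ∑ x ∈ S, h x
  have i1 : 2 * ((S.card - H / (2 * n)) ^ 2 / S.card * L)
      ≤ 2 * D + 4 * (-(Q + L * H) / (2 * n)) + 4 * n * (Q / (2 * n) ^ 2) := by
    refine le_trans ?_ (add_le_add_right e4 _)
    refine le_of_mul_le_mul_left (le_trans (le_of_eq ?_) iso) hc
    ring
  -- Only the square of H/(2n) is dropped; the linear term in H cancels exactly against that of the
  -- mixed term in `i3`.
  have i2 : (S.card - H / n) * L ≤ (S.card - H / (2 * n)) ^ 2 / S.card * L := by
    refine mul_le_mul_of_nonneg_right ?_ hL0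
    rw [le_div_iff₀ hSpos]
    have := sq_nonneg (H / (2 * n))
    have e : H / n = 2 * (H / (2 * n)) := by field_simp
    rw [e]
    nlinarith
  have i3 : 4 * (-(Q + L * H) / (2 * n)) + 4 * n * (Q / (2 * n) ^ 2)
      = -Q / n - 2 * (H / n) * L := by
    field_simp; ring
  have i4 : Q / n ≤ 2 * (D - S.card * L) := by
    have : -Q / n = -(Q / n) := by ring
    linarith
  rw [div_le_iff₀ hn'] at i4
  linarith

/-- Chebyshev's inequality for the uniform distribution on a finite set. -/
theorem uniformOn_real_ge_of_sum_sq_le {V : Type*} [Fintype V] [DecidableEq V]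
    [MeasurableSpace V] [MeasurableSingletonClass V]
    (S : Finset V) (hS : S.Nonempty) (f : V → ℝ) {L c δ : ℝ} (hL : 0 ≤ L) (hδ : 0 < δ)
    (hf : ∑ x ∈ S, (f x - L) ^ 2 ≤ c * (S.card * L ^ 2)) (hc : 0 ≤ c) (T : Set V)
    (hT : ∀ x ∈ S, |f x - L| ≤ δ * L → x ∈ T) :
    1 - c / δ ^ 2 ≤ (ProbabilityTheory.uniformOn (S : Set V)).real T := by
  classical
  have hSpos : (0 : ℝ) < S.card := by exact_mod_cast hS.card_pos
  have hval : (ProbabilityTheory.uniformOn (S : Set V)).real T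
      = (S.filter (· ∈ T)).card / S.card := by
    rw [MeasureTheory.measureReal_def, ProbabilityTheory.uniformOn,
      ProbabilityTheory.cond_apply S.measurableSet,
      show (S : Set V) ∩ T = (S.filter (· ∈ T) : Finset V) by ext; simp,
      MeasureTheory.Measure.count_apply_finset, MeasureTheory.Measure.count_apply_finset]
    simp [ENNReal.toReal_mul, ENNReal.toReal_inv]
    ring
  have hsplit : ((S.filter (· ∈ T)).card : ℝ) + (S.filter (· ∉ T)).card = S.card := by
    exact_mod_cast Finset.card_filter_add_card_filter_not (s := S) (· ∈ T)
  rw [hval, le_div_iff₀ hSpos]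
  set B := S.filter (· ∉ T) with hB
  have hfar : ∀ x ∈ B, δ * L < |f x - L| := by
    intro x hx
    rw [hB, Finset.mem_filter] at hx
    by_contra! h
    exact hx.2 (hT x hx.1 h)
  have hbad : (B.card : ℝ) ≤ c / δ ^ 2 * S.card := by
    -- For L = 0 one cannot divide by L², but the moment bound then forces f = 0 on S.
    rcases hL.eq_or_lt with rfl | hL
    · have : B = ∅ := by
        rw [Finset.eq_empty_iff_forall_notMem]
        intro x hx
        have h1 := hfar x hx
        have h2 := Finset.single_le_sum (f := fun x => (f x - 0) ^ 2) (fun y _ => sq_nonneg _)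
          (Finset.mem_of_mem_filter x hx)
        have h3 : 0 < (f x - 0) ^ 2 := by
          rw [mul_zero, abs_pos] at h1
          positivity
        simp only [ne_eq, OfNat.ofNat_ne_zero, not_false_eq_true, zero_pow, mul_zero] at hf
        linarith
      rw [this]
      simp only [Finset.card_empty, Nat.cast_zero]
      positivity
    · have h1 : B.card * (δ * L) ^ 2 ≤ ∑ x ∈ S, (f x - L) ^ 2 := by
        rw [← nsmul_eq_mul]
        refine (Finset.card_nsmul_le_sum B (fun x => (f x - L) ^ 2) _ fun x hx => ?_).trans
          (Finset.sum_le_sum_of_subset_of_nonneg (Finset.filter_subset _ _)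
            fun _ _ _ => sq_nonneg _)
        rw [← sq_abs (f x - L)]
        have := (hfar x hx).le
        gcongr
      have h2 := h1.trans hf
      rw [div_mul_eq_mul_div, le_div_iff₀ (by positivity)]
      refine le_of_mul_le_mul_right (le_trans (le_of_eq ?_) (h2.trans (le_of_eq ?_)))
        (show 0 < L ^ 2 by positivity) <;> ring
  have : (1 - c / δ ^ 2) * S.card = S.card - c / δ ^ 2 * S.card := by ring
  linarith

theorem corollary3p2 (n : ℕ) (hn : 1 ≤ n)
    (A : Set (Fin n → Bool)) (hA : A.Nonempty)
    (ε ε' δ : ℝ) (hε'0 : 0 ≤ ε') (hε'1 : ε' ≤ 1) (hδ0 : 0 < δ) (hδ1 : δ ≤ 1)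
    (hε : ε = ε' / (2 * n) * Real.logb 2 (2 ^ n / A.ncard))
    (hbd : ((edgeBoundary (cubeGraph n) A).ncard : ℝ)
      ≤ (1 + ε) * (A.ncard * Real.logb 2 (2 ^ n / A.ncard))) :
    1 - ε' / δ ^ 2 ≤ (ProbabilityTheory.uniformOn A).real
        {x | (1 - δ) * Real.logb 2 (2 ^ n / A.ncard) ≤ outDegree (cubeGraph n) A x ∧
          (outDegree (cubeGraph n) A x : ℝ)
            ≤ (1 + ε) * (1 + δ) * Real.logb 2 (2 ^ n / A.ncard)} ∧
    1 - ε' / δ ^ 2 ≤ (ProbabilityTheory.uniformOn A).real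
        {x | ∃ hx : x ∈ A,
          Real.logb 2 A.ncard - ((1 + ε) * (1 + δ) - 1) * Real.logb 2 (2 ^ n / A.ncard)
            ≤ inducedDegree (cubeGraph n) A ⟨x, hx⟩ ∧
          (inducedDegree (cubeGraph n) A ⟨x, hx⟩ : ℝ)
            ≤ Real.logb 2 A.ncard + δ * Real.logb 2 (2 ^ n / A.ncard)} := by
  classical
  have hn' : (0 : ℝ) < n := by exact_mod_cast hn
  have hcard : A.ncard = A.toFinset.card := Set.ncard_eq_toFinset_card' A
  have hSne : A.toFinset.Nonempty := by simpa using hA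
  have hpos : (0 : ℝ) < A.ncard := by rw [hcard]; exact_mod_cast hSne.card_pos
  have hL : Real.logb 2 (2 ^ n / A.ncard) = n - Real.logb 2 A.ncard := by
    rw [Real.logb_div (by positivity) hpos.ne', Real.logb_pow, Real.logb_self_eq_one one_lt_two,
      mul_one]
  have hL0 : 0 ≤ Real.logb 2 (2 ^ n / A.ncard) := by
    apply Real.logb_nonneg one_lt_two
    rw [one_le_div hpos, hcard]
    have := A.toFinset.card_le_univ
    simp only [Fintype.card_pi, Fintype.card_bool, Finset.prod_const, Finset.card_univ,
      Fintype.card_fin] at this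
    exact_mod_cast this
  have hmom := sum_sq_outDegree_sub_le hn A hA hL
  set L := Real.logb 2 (2 ^ n / A.ncard) with hLdef
  have hε0 : 0 ≤ ε := by rw [hε]; positivity
  have hmom' : ∑ x ∈ A.toFinset, ((outDegree (cubeGraph n) A x : ℝ) - L) ^ 2
      ≤ ε' * (A.toFinset.card * L ^ 2) := by
    refine hmom.trans ?_
    calc _ ≤ 2 * n * ((1 + ε) * (A.ncard * L) - A.ncard * L) := by gcongr
      _ = 2 * n * ε * (A.ncard * L) := by ring
      _ = _ := by rw [hε, hcard]; field_simp
  have hgood : ∀ x, |(outDegree (cubeGraph n) A x : ℝ) - L| ≤ δ * L →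
      (1 - δ) * L ≤ outDegree (cubeGraph n) A x ∧
        (outDegree (cubeGraph n) A x : ℝ) ≤ (1 + ε) * (1 + δ) * L := by
    intro x hx
    rw [abs_le] at hx
    have : 0 ≤ ε * ((1 + δ) * L) := by positivity
    constructor <;> linarith [hx.1, hx.2]
  have cheb := uniformOn_real_ge_of_sum_sq_le A.toFinset hSne
    (fun x => (outDegree (cubeGraph n) A x : ℝ)) hL0 hδ0 hmom' hε'0
  rw [Set.coe_toFinset] at cheb
  refine ⟨cheb _ fun x _ hx => hgood x hx, cheb _ fun x hxS hx => ?_⟩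
  have hxA : x ∈ A := by simpa using hxS
  have hdeg : (inducedDegree (cubeGraph n) A ⟨x, hxA⟩ : ℝ) + outDegree (cubeGraph n) A x = n := by
    exact_mod_cast inducedDegree_add_outDegree A ⟨x, hxA⟩
  obtain ⟨h1, h2⟩ := hgood x hx
  exact ⟨hxA, by linarith, by linarith⟩
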